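/- **Incompleteness theorem for $\Omega$.** Programs and outputs are finite bit strings. A *self-delimiting computer* is a partial computable function $C$ from bit strings to bit strings whose domain is prefix-free, and $H_C(x)=\min\{|p| : C(p)=x\}$ (with $\min\emptyset=\infty$). Let $U$ be a computer, given by a computable transition system, that reads its program one bit at a time, asking for each bit itself, that may display strings during its computation, and that may halt with an output. Write $U(p)=x$ if $U$, run on $p$, halts with output $x$ after reading all of $p$ without asking for a further bit. Assume that $U$ is universal: for every self-delimiting computer $C$ there is a constant $c_C$ with $H_U(x)\le H_C(x)+c_C$ for all $x$. Let $$\Omega=\sum_{U(p)\text{ halts}}2^{-|p|}$$ be its halting probability. A program $p$ *enumerates* a set $T$ of strings if the (possibly unending) computation of $U$ on $p$ reads all of $p$, never asks for a bit beyond its end, and displays exactly the elements of $T$. The *complexity* of a formal theory with set of theorems $T$ is the length of the shortest program that enumerates $T$. Fix a formal language whose sentences are bit strings, with a notion of truth, in which for all $k$ and $b\in\{0,1\}$ there is a sentence $\sigma_{k,b}$, computable from $k$ and $b$, that is true if and only if the $k$-th bit after the binary point in the base-two expansion of $\Omega$ is $b$. Then there is a constant $c$ such that for every $N$ and every formal theory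 $T$ of complexity $N$ in this language all of whose theorems are true, there are at most $N+c$ positions $k$, consecutive or not, for which $T$ determines the $k$-th bit of $\Omega$, that is, contains $\sigma_{k,0}$ or $\sigma_{k,1}$. -/

import Mathlib

/-- A computer that reads its binary program one bit at a time and itself decides when to ask for
the next bit. Configurations are coded by natural numbers, outputs by finite bit strings; every
part of the description is computable.
* In a configuration `s` with `result s = some x` the computer has halted with output `x`.
* Otherwise, if `reads s`, it asks for the next program bit `b` and goes to `next s (some b)`.
* Otherwise it goes to `next s none`, without looking at its program.
* In a configuration `s` with `display s = some x` it displays the string `x`; thus a computation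
  that never halts can still produce an infinite set of outputs. -/
structure BitComputer where
  start : ℕ
  reads : ℕ → Bool
  next : ℕ → Option Bool → ℕ
  display : ℕ → Option (List Bool)
  result : ℕ → Option (List Bool)
  computable_reads : Computable reads
  computable_next : Computable₂ next
  computable_display : Computable display
  computable_result : Computable result

/-- A self-delimiting computer, abstractly: a partial computable function on bit strings such that
no proper extension of a valid program is a valid program. -/
structure IsSelfDelimiting (C : List Bool →. List Bool) : Prop where
  partrec : Partrec C
  prefixFree : ∀ p q, p ∈ C.Dom → q ∈ C.Dom → p <+: q → p = q

/-- Program-size complexity: the length of a shortest `p` with `C p = x` (`⊤` if there is none). -/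
noncomputable def complexity (C : List Bool →. List Bool) (x : List Bool) : ℕ∞ :=
  ⨅ (p : List Bool) (_ : x ∈ C p), (p.length : ℕ∞)

namespace BitComputer

variable (U : BitComputer)

/-- One step from a configuration together with the still unread part of the program;
`none` means that the computer ran off the end of its program. -/
def step : ℕ × List Bool → Option (ℕ × List Bool)
  | (s, w) =>
    if (U.result s).isSome then some (s, w)
    else if U.reads s then
      match w with
      | [] => none
      | b :: w' => some (U.next s (some b), w')
    else some (U.next s none, w)

/-- The situation after `n` steps on the program `p`. -/
def run (p : List Bool) : ℕ → Option (ℕ × List Bool)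
  | 0 => some (U.start, p)
  | n + 1 => (run p n).bind U.step

/-- The output at time `n`, if the computer has halted by then after reading exactly `p`. -/
def outputAt (p : List Bool) (n : ℕ) : Option (List Bool) :=
  (U.run p n).bind fun c => if c.2 = [] then U.result c.1 else none

/-- The function computed by halting computations: `U.eval p` is defined, with value `x`, iff the
computer on program `p` halts with output `x` after reading all of `p` and nothing beyond. -/
def eval : List Bool →. List Bool := fun p => Nat.rfindOpt (U.outputAt p)

/-- On program `p` the computer at some time displays `x`. -/
def Displays (p x : List Bool) : Prop :=
  ∃ n s w, U.run p n = some (s, w) ∧ U.display s = some x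

/-- `p` is a self-delimiting program enumerating the set `T`: the (usually unending) computation
on `p` reads all of `p`, never tries to read beyond it, and displays exactly the elements
of `T`. -/
def Enumerates (p : List Bool) (T : Set (List Bool)) : Prop :=
  (∀ n, U.run p n ≠ none) ∧ (∃ n s, U.run p n = some (s, [])) ∧ ∀ x, U.Displays p x ↔ x ∈ T

/-- The complexity of a formal theory with set of theorems `T`: the length of a shortest
self-delimiting program enumerating `T` (`⊤` if there is none). -/
noncomputable def theoryComplexity (T : Set (List Bool)) : ℕ∞ :=
  ⨅ (p : List Bool) (_ : U.Enumerates p T), (p.length : ℕ∞)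

/-- `U` is universal: up to an additive constant, its programs are no longer than those of any
self-delimiting computer. -/
def IsUniversal : Prop :=
  ∀ C : List Bool →. List Bool, IsSelfDelimiting C →
    ∃ c : ℕ, ∀ x, complexity U.eval x ≤ complexity C x + c

/-- The halting probability of `U`. -/
noncomputable def omega : ℝ :=
  ∑' p : {p : List Bool // (U.eval p).Dom}, (1 / 2 : ℝ) ^ p.1.length

end BitComputer

/-!
The bits of `Ω` are incompressible: given its first `n` bits, one can wait until every program
shorter than `n` bits that will ever halt has halted, and then name a string which none of these
programs produces. Hence `n ≤ H(Ω₀ … Ωₙ₋₁) + O(1)`.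

On the other hand, suppose that the theorems enumerated by a program `p` settle `|p| + 2k` bits.
Run `p` until the number of settled bits among the first `s` exceeds the number of bits of `p` read
so far by `2k`, and supply the bits that are not settled explicitly. This is a self-delimiting
description of the first `s` bits of length at most `s - 2k`. Passing the parameter `k` in unary
costs `k + O(1)` further bits, so the net gain of `k - O(1)` bits contradicts incompressibility as
soon as `k` exceeds a constant that does not depend on `p`.
-/

open Encodable Filter

/-! ### Prefix-free sets of strings -/

section Kraft

open InformationTheory

theorem uniquelyDecodable_of_isAntichain_prefix {α : Type*} {S : Set (List α)} (hnil : [] ∉ S)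
    (hS : IsAntichain (· <+: ·) S) : UniquelyDecodable S := by
  intro L₁
  induction L₁ with
  | nil =>
    rintro (_ | ⟨q, L₂⟩) - h₂ h
    · rfl
    · have hq : q = [] := (List.append_eq_nil_iff.1 h.symm).1
      exact absurd (hq ▸ h₂ q List.mem_cons_self) hnil
  | cons p L₁ ih =>
    rintro (_ | ⟨q, L₂⟩) h₁ h₂ h
    · have hp : p = [] := (List.append_eq_nil_iff.1 h).1
      exact absurd (hp ▸ h₁ p List.mem_cons_self) hnil
    · rw [List.forall_mem_cons] at h₁ h₂
      rw [List.flatten_cons, List.flatten_cons] at h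
      obtain rfl : p = q := by
        have hp : p <+: q ++ L₂.flatten := h ▸ List.prefix_append p _
        obtain hpq | hqp := List.prefix_or_prefix_of_prefix hp (List.prefix_append q _)
        · exact hS.eq h₁.1 h₂.1 hpq
        · exact hS.eq' h₁.1 h₂.1 hqp
      rw [ih L₂ h₁.2 h₂.2 (List.append_cancel_left h)]

theorem kraft_inequality_of_isAntichain_prefix {α : Type*} [Fintype α] [Nonempty α]
    {S : Finset (List α)} (hS : IsAntichain (· <+: ·) (S : Set (List α))) :
    ∑ p ∈ S, (1 / Fintype.card α : ℝ) ^ p.length ≤ 1 := by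
  by_cases hnil : [] ∈ S
  · have hsingle : S = {[]} :=
      Finset.eq_singleton_iff_unique_mem.2
        ⟨hnil, fun q hq => (hS.eq hnil hq List.nil_prefix).symm⟩
    simp [hsingle]
  · exact kraft_mcmillan_inequality
      (uniquelyDecodable_of_isAntichain_prefix (Finset.mem_coe.not.2 hnil) hS)

theorem summable_indicator_of_isAntichain_prefix {α : Type*} [Fintype α] [Nonempty α]
    {S : Set (List α)} (hS : IsAntichain (· <+: ·) S) :
    Summable (S.indicator fun p => (1 / Fintype.card α : ℝ) ^ p.length) := by
  classical
  refine summable_of_sum_le (c := 1) (Set.indicator_nonneg fun p _ => by positivity) fun F => ?_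
  rw [Finset.sum_indicator_eq_sum_filter]
  have hF : IsAntichain (· <+: ·) ((F.filter (· ∈ S) : Finset (List α)) : Set (List α)) :=
    hS.subset fun p hp => (Finset.mem_filter.1 hp).2
  exact kraft_inequality_of_isAntichain_prefix hF

end Kraft

/-! ### Computable functions on lists -/

section Computability

variable {α β : Type*} [Primcodable α] [Primcodable β]

theorem computable_filterMap_range {f : α → ℕ} {g : α → ℕ → Option β} (hf : Computable f)
    (hg : Computable₂ g) : Computable fun a => (List.range (f a)).filterMap (g a) := by
  have hstep : Computable₂ fun (a : α) (q : ℕ × List β) => q.2 ++ (g a q.1).toList :=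
    Computable.list_append.comp (Computable.snd.comp .snd)
      (Primrec.optionToList.to_comp.comp (hg.comp .fst (Computable.fst.comp .snd)))
  refine (Computable.nat_rec hf (.const []) hstep).of_eq fun a => ?_
  induction f a with
  | zero => rfl
  | succ n ih =>
    rw [List.range_succ, List.filterMap_append, ← ih]
    cases h : g a n <;> simp [h]

theorem computable_map_range {f : α → ℕ} {g : α → ℕ → β} (hf : Computable f)
    (hg : Computable₂ g) : Computable fun a => (List.range (f a)).map (g a) :=
  (computable_filterMap_range hf (Computable.option_some.comp hg).to₂).of_eq fun _ =>
    congrFun List.filterMap_eq_map _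

theorem primrec_list_sum : Primrec (List.sum : List ℕ → ℕ) :=
  Primrec.list_foldr .id (.const 0)
    (Primrec.nat_add.comp (Primrec.fst.comp .snd) (Primrec.snd.comp .snd)).to₂

theorem primrec_two_pow : Primrec fun n : ℕ => 2 ^ n := by
  refine (Primrec.nat_rec₁ 1 (f := fun _ m => 2 * m)
    (Primrec.nat_double.comp .snd)).of_eq fun n => ?_
  induction n with
  | zero => rfl
  | succ n ih => rw [pow_succ', ← ih]

theorem primrecRel_mem_list : PrimrecRel fun (a : α) (l : List α) => a ∈ l :=
  (Primrec.eq.exists_mem_list.comp Primrec.snd Primrec.fst).of_eq fun q => by simp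

end Computability

section FillGaps

variable {α : Type*} [Inhabited α]

/-- Replaces the gaps `none` of a partially known string, from left to right, by the elements of a
second list. -/
def fillGaps : List (Option α) → List α → List α
  | [], _ => []
  | some a :: l, z => a :: fillGaps l z
  | none :: l, z => z.headI :: fillGaps l z.tail

theorem exists_fillGaps_eq {l : List (Option α)} {x : List α}
    (h : List.Forall₂ (fun o a => ∀ b ∈ o, b = a) l x) :
    ∃ z, z.length = l.countP Option.isNone ∧ fillGaps l z = x := by
  induction h with
  | nil => exact ⟨[], rfl, rfl⟩
  | @cons o a l x ho _ ih =>
    obtain ⟨z, hz, rfl⟩ := ih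
    cases o with
    | none => exact ⟨a :: z, by simp [hz], rfl⟩
    | some b => exact ⟨z, by simp [hz], by rw [fillGaps, ho b rfl]⟩

theorem primrec_fillGaps [Primcodable α] : Primrec₂ (fillGaps : List (Option α) → List α → _) := by
  let step (q : List α × List α) (o : Option α) : List α × List α :=
    (q.1 ++ [o.getD q.2.headI], bif o.isSome then q.2 else q.2.tail)
  have hunused : Primrec fun q : (List α × List α) × Option α => q.1.2 := Primrec.snd.comp .fst
  have hstep : Primrec₂ step :=
    Primrec.pair
      (Primrec.list_concat.comp (Primrec.fst.comp .fst)
        (Primrec.option_getD.comp .snd (Primrec.list_headI.comp hunused)))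
      (Primrec.cond (Primrec.option_isSome.comp .snd) hunused (Primrec.list_tail.comp hunused))
  have hfold (l : List (Option α)) (acc z : List α) :
      (l.foldl step (acc, z)).1 = acc ++ fillGaps l z := by
    induction l generalizing acc z with
    | nil => simp [fillGaps]
    | cons o l ih => cases o <;> simp [step, fillGaps, ih]
  exact (Primrec.fst.comp (Primrec.list_foldl .fst (Primrec.pair (.const []) .snd)
    (hstep.comp (Primrec.fst.comp .snd) (Primrec.snd.comp .snd)).to₂)).of_eq
      fun q => hfold q.1 [] q.2

end FillGaps

/-! ### Self-delimiting computers and complexity -/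

section UnaryIndex

/-- Splits `1 ^ k 0 v` into the number `k`, written in unary, and the string `v`. -/
def splitUnary : List Bool → Option (ℕ × List Bool)
  | [] => none
  | false :: v => some (0, v)
  | true :: w => (splitUnary w).map fun q => (q.1 + 1, q.2)

theorem splitUnary_replicate_append (k : ℕ) (v : List Bool) :
    splitUnary (List.replicate k true ++ false :: v) = some (k, v) := by
  induction k with
  | zero => rfl
  | succ k ih => simp [List.replicate_succ, splitUnary, ih]

theorem eq_replicate_append_of_splitUnary {w v : List Bool} {k : ℕ}
    (h : splitUnary w = some (k, v)) : w = List.replicate k true ++ false :: v := by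
  induction w generalizing k with
  | nil => cases h
  | cons b w ih =>
    cases b with
    | false =>
      cases h
      rfl
    | true =>
      obtain ⟨⟨k, v⟩, hw, hkv⟩ := Option.map_eq_some_iff.1 h
      cases hkv
      rw [ih hw, List.replicate_succ, List.cons_append]

theorem primrec_splitUnary : Primrec splitUnary := by
  have hsucc : Primrec fun o : Option (ℕ × List Bool) => o.map fun q => (q.1 + 1, q.2) :=
    Primrec.option_map₁ (Primrec.pair (Primrec.succ.comp .fst) .snd)
  have hstep : Primrec₂ fun (_ : List Bool) (q : Bool × List Bool × Option (ℕ × List Bool)) =>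
      bif q.1 then q.2.2.map fun q => (q.1 + 1, q.2) else some (0, q.2.1) :=
    Primrec.cond (Primrec.fst.comp .snd) (hsucc.comp (Primrec.snd.comp (Primrec.snd.comp .snd)))
      (Primrec.option_some.comp
        (Primrec.pair (.const 0) (Primrec.fst.comp (Primrec.snd.comp .snd))))
  refine (Primrec.list_rec .id (.const none) hstep).of_eq fun w => ?_
  induction w with
  | nil => rfl
  | cons b w ih =>
    cases b with
    | false => rfl
    | true => exact congrArg (Option.map _) ih

/-- The computer that on input `1 ^ k 0 v` runs the `k`-th member of the family `E` on `v`. -/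
def unaryIndexed (E : ℕ → List Bool →. List Bool) : List Bool →. List Bool := fun w =>
  (splitUnary w : Part (ℕ × List Bool)).bind fun q => E q.1 q.2

theorem mem_unaryIndexed {E : ℕ → List Bool →. List Bool} {w x : List Bool} :
    x ∈ unaryIndexed E w ↔ ∃ k v, w = List.replicate k true ++ false :: v ∧ x ∈ E k v := by
  simp only [unaryIndexed, Part.mem_bind_iff, Part.mem_coe, Option.mem_def, Prod.exists]
  refine exists₂_congr fun k v => and_congr_left fun _ => ⟨eq_replicate_append_of_splitUnary, ?_⟩
  rintro rfl
  exact splitUnary_replicate_append k v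

theorem isSelfDelimiting_unaryIndexed {E : ℕ → List Bool →. List Bool} (hE : Partrec₂ E)
    (hdom : ∀ k, IsAntichain (· <+: ·) (E k).Dom) : IsSelfDelimiting (unaryIndexed E) where
  partrec := (Computable.ofOption primrec_splitUnary.to_comp).bind
    (hE.comp (Computable.fst.comp .snd) (Computable.snd.comp .snd))
  prefixFree := by
    rintro w w' hw hw' ⟨r, rfl⟩
    obtain ⟨x, hx⟩ := Part.dom_iff_mem.1 hw
    obtain ⟨x', hx'⟩ := Part.dom_iff_mem.1 hw'
    obtain ⟨k, v, rfl, hv⟩ := mem_unaryIndexed.1 hx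
    obtain ⟨k', v', heq, hv'⟩ := mem_unaryIndexed.1 hx'
    have hsplit := splitUnary_replicate_append k (v ++ r)
    rw [← List.cons_append, ← List.append_assoc, heq, splitUnary_replicate_append] at hsplit
    cases hsplit
    have hvr : v = v ++ r :=
      (hdom k).eq (Part.dom_iff_mem.2 ⟨x, hv⟩) (Part.dom_iff_mem.2 ⟨x', hv'⟩)
        (List.prefix_append v r)
    rw [List.self_eq_append_right.1 hvr, List.append_nil]

end UnaryIndex

theorem complexity_le_of_mem {C : List Bool →. List Bool} {p x : List Bool} (h : x ∈ C p) :
    complexity C x ≤ p.length :=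
  iInf₂_le p h

namespace IsSelfDelimiting

theorem bind {C F : List Bool →. List Bool} (hC : IsSelfDelimiting C) (hF : Partrec F) :
    IsSelfDelimiting fun p => (C p).bind F where
  partrec := hC.partrec.bind (hF.comp .snd)
  prefixFree _ _ hp hq := hC.prefixFree _ _ hp.1 hq.1

end IsSelfDelimiting

theorem complexity_bind_le {C F : List Bool →. List Bool} {x y : List Bool} (h : y ∈ F x) :
    complexity (fun p => (C p).bind F) y ≤ complexity C x :=
  le_iInf₂ fun _ hp => complexity_le_of_mem (Part.mem_bind hp h)

/-! ### Runs, universality and the halting probability -/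

namespace BitComputer

variable {U : BitComputer}

theorem run_succ (v : List Bool) (n : ℕ) : U.run v (n + 1) = (U.run v n).bind U.step := rfl

theorem run_eq_of_result_isSome {v w : List Bool} {m n σ : ℕ} (h : U.run v m = some (σ, w))
    (hσ : (U.result σ).isSome) (hmn : m ≤ n) : U.run v n = some (σ, w) := by
  induction n, hmn using Nat.le_induction with
  | base => exact h
  | succ n _ ih => simp [run_succ, ih, step, hσ]

theorem isSome_run_of_le {v : List Bool} {m n : ℕ} (hmn : m ≤ n) (h : (U.run v n).isSome) :
    (U.run v m).isSome := by
  induction n, hmn using Nat.le_induction with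
  | base => exact h
  | succ n _ ih => exact ih (Option.isSome_of_isSome_bind h)

theorem step_append {σ τ : ℕ} {w w' : List Bool} (h : U.step (σ, w) = some (τ, w'))
    (r : List Bool) : U.step (σ, w ++ r) = some (τ, w' ++ r) := by
  cases w <;> simp only [step] at h ⊢ <;> split_ifs at h ⊢ <;> simp_all

theorem exists_step_prefix {σ τ : ℕ} {w w' : List Bool} (h : U.step (σ, w) = some (τ, w')) :
    ∃ u, w = u ++ w' ∧ U.step (σ, u) = some (τ, []) := by
  simp only [step] at h ⊢
  split_ifs at h ⊢ with hresult hreads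
  · cases h
    exact ⟨[], rfl, rfl⟩
  · cases w with
    | nil => cases h
    | cons b w =>
      cases h
      exact ⟨[b], rfl, rfl⟩
  · cases h
    exact ⟨[], rfl, rfl⟩

theorem run_append {σ n : ℕ} {v w : List Bool} (h : U.run v n = some (σ, w)) (r : List Bool) :
    U.run (v ++ r) n = some (σ, w ++ r) := by
  induction n generalizing σ w with
  | zero =>
    cases h
    rfl
  | succ n ih =>
    obtain ⟨⟨τ, u⟩, hrun, hstep⟩ := Option.bind_eq_some_iff.1 h
    rw [run_succ, ih hrun, Option.bind_some, step_append hstep]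

theorem exists_run_prefix {σ n : ℕ} {v w : List Bool} (h : U.run v n = some (σ, w)) :
    ∃ p, v = p ++ w ∧ U.run p n = some (σ, []) := by
  induction n generalizing σ w with
  | zero =>
    cases h
    exact ⟨[], rfl, rfl⟩
  | succ n ih =>
    obtain ⟨⟨τ, w'⟩, hrun, hstep⟩ := Option.bind_eq_some_iff.1 h
    obtain ⟨p, rfl, hp⟩ := ih hrun
    obtain ⟨u, rfl, hu⟩ := exists_step_prefix hstep
    exact ⟨p ++ u, (List.append_assoc p u w).symm, by rw [run_succ, run_append hp u]; exact hu⟩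

theorem outputAt_eq_some {p x : List Bool} {n : ℕ} :
    U.outputAt p n = some x ↔ ∃ σ, U.run p n = some (σ, []) ∧ U.result σ = some x := by
  simp [outputAt, Option.bind_eq_some_iff]

theorem outputAt_mono {p x : List Bool} {m n : ℕ} (hmn : m ≤ n) (h : U.outputAt p m = some x) :
    U.outputAt p n = some x := by
  obtain ⟨σ, hrun, hσ⟩ := outputAt_eq_some.1 h
  exact outputAt_eq_some.2 ⟨σ, run_eq_of_result_isSome hrun (by simp [hσ]) hmn, hσ⟩

theorem mem_eval {p x : List Bool} : x ∈ U.eval p ↔ ∃ n, U.outputAt p n = some x :=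
  Nat.rfindOpt_mono outputAt_mono

theorem isAntichain_dom_eval : IsAntichain (· <+: ·) U.eval.Dom := by
  rintro p hp _ hq hne ⟨r, rfl⟩
  obtain ⟨x, hx⟩ := Part.dom_iff_mem.1 hp
  obtain ⟨y, hy⟩ := Part.dom_iff_mem.1 hq
  obtain ⟨m, hm⟩ := mem_eval.1 hx
  obtain ⟨n, hn⟩ := mem_eval.1 hy
  obtain ⟨σ, hrun, -⟩ := outputAt_eq_some.1 (outputAt_mono (le_max_left m n) hm)
  obtain ⟨τ, hrun', -⟩ := outputAt_eq_some.1 (outputAt_mono (le_max_right m n) hn)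
  rw [run_append hrun r] at hrun'
  cases hrun'
  exact hne (List.append_nil p).symm

section Computability

variable (U)

theorem computable_step : Computable U.step := by
  have hread : Computable fun c : ℕ × List Bool =>
      c.2.head?.map fun b => (U.next c.1 (some b), c.2.tail) :=
    .option_map (Primrec.list_head?.to_comp.comp .snd)
      (Computable.pair
        (U.computable_next.comp (Computable.fst.comp .fst) (Computable.option_some.comp .snd))
        (Primrec.list_tail.to_comp.comp (Computable.snd.comp .fst))).to₂
  have hsilent : Computable fun c : ℕ × List Bool => some (U.next c.1 none, c.2) :=
    Computable.option_some.comp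
      (Computable.pair (U.computable_next.comp .fst (.const none)) .snd)
  refine (Computable.cond (Primrec.option_isSome.to_comp.comp (U.computable_result.comp .fst))
    .option_some (.cond (U.computable_reads.comp .fst) hread hsilent)).of_eq fun ⟨σ, w⟩ => ?_
  simp only [step]
  cases (U.result σ).isSome <;> cases U.reads σ <;> cases w <;> rfl

theorem computable_run : Computable₂ U.run := by
  have hstep : Computable₂ fun (_ : List Bool × ℕ) (q : ℕ × Option (ℕ × List Bool)) =>
      q.2.bind U.step :=
    .option_bind (Computable.snd.comp .snd) (U.computable_step.comp .snd).to₂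
  refine (Computable.nat_rec .snd (Computable.option_some.comp (.pair (.const U.start) .fst))
    hstep).of_eq fun ⟨p, n⟩ => ?_
  induction n with
  | zero => rfl
  | succ n ih => exact congrArg (Option.bind · U.step) ih

theorem computable_outputAt : Computable₂ U.outputAt := by
  have hnil : Computable fun w : List Bool => decide (w = []) :=
    (Primrec.eq.comp .id (.const [])).decide.to_comp
  have hfinished : Computable₂ fun (_ : List Bool × ℕ) (c : ℕ × List Bool) =>
      bif decide (c.2 = []) then U.result c.1 else none :=
    .cond (hnil.comp (Computable.snd.comp .snd))
      (U.computable_result.comp (Computable.fst.comp .snd)) (.const none)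
  refine (Computable.option_bind U.computable_run hfinished).of_eq fun q => ?_
  simp [outputAt, cond_eq_ite]

theorem isSelfDelimiting_eval : IsSelfDelimiting U.eval where
  partrec := Partrec.rfindOpt U.computable_outputAt
  prefixFree _ _ hp hq h := isAntichain_dom_eval.eq hp hq h

end Computability

namespace IsUniversal

theorem exists_complexity_le_of_partrec (hU : U.IsUniversal) {F : List Bool →. List Bool}
    (hF : Partrec F) :
    ∃ c : ℕ, ∀ x, ∀ y ∈ F x, complexity U.eval y ≤ complexity U.eval x + c := by
  obtain ⟨c, hc⟩ := hU _ (U.isSelfDelimiting_eval.bind hF)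
  exact ⟨c, fun x y hy => (hc y).trans (by gcongr; exact complexity_bind_le hy)⟩

theorem exists_complexity_le_of_family (hU : U.IsUniversal) {E : ℕ → List Bool →. List Bool}
    (hE : Partrec₂ E) (hdom : ∀ k, IsAntichain (· <+: ·) (E k).Dom) :
    ∃ c : ℕ, ∀ k v, ∀ x ∈ E k v, complexity U.eval x ≤ (v.length + k + c : ℕ) := by
  obtain ⟨c, hc⟩ := hU _ (isSelfDelimiting_unaryIndexed hE hdom)
  refine ⟨c + 1, fun k v x hx => (hc x).trans ?_⟩
  have hmem : x ∈ unaryIndexed E (List.replicate k true ++ false :: v) :=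
    mem_unaryIndexed.2 ⟨k, v, rfl, hx⟩
  calc
    complexity (unaryIndexed E) x + c
      ≤ ((List.replicate k true ++ false :: v).length : ℕ∞) + c := by
        gcongr
        exact complexity_le_of_mem hmem
    _ = (v.length + k + (c + 1) : ℕ) := by
        rw [List.length_append, List.length_replicate, List.length_cons]
        push_cast
        ring

end IsUniversal

section HaltingProbability

variable (U)

theorem hasSum_omega :
    HasSum (U.eval.Dom.indicator fun p => (1 / 2 : ℝ) ^ p.length) U.omega := by
  have h := (summable_indicator_of_isAntichain_prefix U.isAntichain_dom_eval).hasSum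
  rwa [Fintype.card_bool, Nat.cast_ofNat, ← tsum_subtype] at h

/-- The programs with code below `t` that halt within `t` steps. -/
def haltedBy (t : ℕ) : List (List Bool) :=
  (List.range t).filterMap fun i =>
    (decode₂ (List Bool) i).bind fun p => (U.outputAt p t).map fun _ => p

/-- The approximation of the halting probability from below at stage `t`. -/
noncomputable def omegaAt (t : ℕ) : ℝ :=
  ∑ p ∈ (U.haltedBy t).toFinset, (1 / 2 : ℝ) ^ p.length

/-- The integer `2 ^ t * omegaAt t`. -/
def scaledOmegaAt (t : ℕ) : ℕ :=
  ((U.haltedBy t).map fun p => 2 ^ (t - p.length)).sum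

/-- A string longer than every output of a program in `haltedBy t`. -/
def freshString (t : ℕ) : List Bool :=
  true :: ((List.range t).filterMap fun i =>
    (decode₂ (List Bool) i).bind fun p => U.outputAt p t).flatten

variable {U}

theorem mem_haltedBy {t : ℕ} {p : List Bool} :
    p ∈ U.haltedBy t ↔ encode p < t ∧ (U.outputAt p t).isSome := by
  simp [haltedBy, Option.isSome_iff_exists, decode₂_eq_some, ← exists_and_left,
    Option.bind_eq_some_iff]

theorem nodup_haltedBy (t : ℕ) : (U.haltedBy t).Nodup := by
  refine List.nodup_range.filterMap fun i j p hi hj => ?_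
  simp only [Option.mem_def, Option.bind_eq_some_iff, Option.map_eq_some_iff,
    decode₂_eq_some] at hi hj
  obtain ⟨_, rfl, _, _, rfl⟩ := hi
  obtain ⟨_, rfl, _, _, rfl⟩ := hj
  rfl

theorem mem_dom_eval_of_mem_haltedBy {t : ℕ} {p : List Bool} (h : p ∈ U.haltedBy t) :
    p ∈ U.eval.Dom := by
  obtain ⟨x, hx⟩ := Option.isSome_iff_exists.1 (mem_haltedBy.1 h).2
  exact Part.dom_iff_mem.2 ⟨x, mem_eval.2 ⟨t, hx⟩⟩

theorem eventually_mem_haltedBy {p : List Bool} (h : p ∈ U.eval.Dom) :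
    ∀ᶠ t in atTop, p ∈ U.haltedBy t := by
  obtain ⟨x, hx⟩ := Part.dom_iff_mem.1 h
  obtain ⟨n, hn⟩ := mem_eval.1 hx
  filter_upwards [eventually_gt_atTop (encode p), eventually_ge_atTop n] with t hpt hnt
  exact mem_haltedBy.2 ⟨hpt, by simp [outputAt_mono hnt hn]⟩

theorem exists_lt_omegaAt {x : ℝ} (hx : x < U.omega) : ∃ t, x < U.omegaAt t := by
  classical
  obtain ⟨F, hF⟩ := (U.hasSum_omega.eventually (lt_mem_nhds hx)).exists
  rw [Finset.sum_indicator_eq_sum_filter] at hF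
  have hhalted : ∀ᶠ t in atTop, ∀ p ∈ F.filter (· ∈ U.eval.Dom), p ∈ U.haltedBy t :=
    (Filter.eventually_all_finset _).2 fun p hp =>
      eventually_mem_haltedBy (Finset.mem_filter.1 hp).2
  obtain ⟨t, ht⟩ := hhalted.exists
  refine ⟨t, hF.trans_le (Finset.sum_le_sum_of_subset_of_nonneg (fun p hp => ?_)
    fun _ _ _ => by positivity)⟩
  exact List.mem_toFinset.2 (ht p hp)

theorem sum_le_omega {F : Finset (List Bool)} (hF : ∀ p ∈ F, p ∈ U.eval.Dom) :
    ∑ p ∈ F, (1 / 2 : ℝ) ^ p.length ≤ U.omega :=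
  calc
    ∑ p ∈ F, (1 / 2 : ℝ) ^ p.length
      = ∑ p ∈ F, U.eval.Dom.indicator (fun p => (1 / 2 : ℝ) ^ p.length) p :=
        Finset.sum_congr rfl fun p hp =>
          (Set.indicator_of_mem (hF p hp) fun p => (1 / 2 : ℝ) ^ p.length).symm
    _ ≤ U.omega := sum_le_hasSum F
        (fun p _ => Set.indicator_nonneg (fun _ _ => by positivity) p) U.hasSum_omega

theorem omegaAt_add_le {t : ℕ} {q : List Bool} (hq : q ∈ U.eval.Dom) (hqt : q ∉ U.haltedBy t) :
    U.omegaAt t + (1 / 2 : ℝ) ^ q.length ≤ U.omega := by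
  have hinsert := sum_le_omega (F := insert q (U.haltedBy t).toFinset) fun p hp => by
    obtain rfl | hp := Finset.mem_insert.1 hp
    · exact hq
    · exact mem_dom_eval_of_mem_haltedBy (List.mem_toFinset.1 hp)
  rwa [Finset.sum_insert (by simpa using hqt), add_comm] at hinsert

theorem cast_scaledOmegaAt (t : ℕ) : (U.scaledOmegaAt t : ℝ) = 2 ^ t * U.omegaAt t := by
  rw [omegaAt, List.sum_toFinset _ (nodup_haltedBy t), ← List.sum_map_mul_left, scaledOmegaAt,
    Nat.cast_list_sum, List.map_map]
  refine congrArg List.sum (List.map_congr_left fun p hp => ?_)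
  have hle : p.length ≤ t := (length_le_encode p).trans (mem_haltedBy.1 hp).1.le
  rw [Function.comp_apply, Nat.cast_pow, Nat.cast_ofNat, pow_sub₀ _ two_ne_zero hle, one_div,
    inv_pow]

theorem length_lt_freshString {t : ℕ} {p x : List Bool} (hp : p ∈ U.haltedBy t)
    (hx : x ∈ U.eval p) : x.length < (U.freshString t).length := by
  obtain ⟨hpt, hhalt⟩ := mem_haltedBy.1 hp
  obtain ⟨y, hy⟩ := Option.isSome_iff_exists.1 hhalt
  obtain rfl := Part.mem_unique hx (mem_eval.2 ⟨t, hy⟩)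
  refine Nat.lt_succ_of_le (List.sublist_flatten_of_mem (List.mem_filterMap.2
    ⟨encode p, List.mem_range.2 hpt, ?_⟩)).length_le
  rw [encodek₂, Option.bind_some, hy]

theorem le_complexity_freshString {n t : ℕ} (h : U.omega < U.omegaAt t + 2 * (1 / 2) ^ n) :
    (n : ℕ∞) ≤ complexity U.eval (U.freshString t) := by
  refine le_iInf₂ fun p hp => Nat.cast_le.2 ?_
  by_contra! hlt
  by_cases hpt : p ∈ U.haltedBy t
  · exact (length_lt_freshString hpt hp).false
  · have hpow : 2 * (1 / 2 : ℝ) ^ n ≤ (1 / 2) ^ p.length :=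
      calc
        2 * (1 / 2 : ℝ) ^ n ≤ 2 * (1 / 2) ^ (p.length + 1) := by
          gcongr ?_ * ?_
          exact pow_le_pow_of_le_one (by norm_num) (by norm_num) hlt
        _ = (1 / 2) ^ p.length := by ring
    linarith [omegaAt_add_le (Part.dom_iff_mem.2 ⟨_, hp⟩) hpt]

section Computability

variable (U)

theorem computable_haltedBy : Computable U.haltedBy := by
  have hhalted : Computable₂ fun (q : ℕ × ℕ) (p : List Bool) => (U.outputAt p q.1).map fun _ => p :=
    .option_map (U.computable_outputAt.comp .snd (Computable.fst.comp .fst))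
      (Computable.snd.comp .fst).to₂
  exact computable_filterMap_range .id
    (Computable.option_bind (Primrec.decode₂.to_comp.comp .snd) hhalted).to₂

theorem computable_scaledOmegaAt : Computable U.scaledOmegaAt := by
  have hweight : Primrec₂ fun (q : ℕ × List (List Bool)) (p : List Bool) =>
      2 ^ (q.1 - p.length) :=
    primrec_two_pow.comp
      (Primrec.nat_sub.comp (Primrec.fst.comp .fst) (Primrec.list_length.comp .snd))
  have hsum : Primrec fun q : ℕ × List (List Bool) => (q.2.map fun p => 2 ^ (q.1 - p.length)).sum :=
    primrec_list_sum.comp (Primrec.list_map .snd hweight)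
  exact hsum.to_comp.comp (Computable.pair .id U.computable_haltedBy)

theorem computable_freshString : Computable U.freshString := by
  have houtput : Computable₂ fun (q : ℕ × ℕ) (p : List Bool) => U.outputAt p q.1 :=
    U.computable_outputAt.comp .snd (Computable.fst.comp .fst)
  exact Computable.list_cons.comp (.const true) (Primrec.list_flatten.to_comp.comp
    (computable_filterMap_range .id
      (Computable.option_bind (Primrec.decode₂.to_comp.comp .snd) houtput).to₂))

end Computability

end HaltingProbability

end BitComputer

/-! ### Incompressibility of the bits of `Ω` -/

section BinaryDigits

/-- The `k`-th binary digit of `x` after the point (counting from `0`), as a truth value. -/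
noncomputable def binaryDigit (x : ℝ) (k : ℕ) : Bool :=
  finTwoEquiv (Real.digits x 2 k)

/-- The number whose binary expansion is that of `a` followed by the string `x`. -/
def appendBits (a : ℕ) (x : List Bool) : ℕ :=
  x.foldl (fun m b => Nat.bit b m) a

theorem floor_mul_pow_succ_eq (x : ℝ) (b : ℕ) [NeZero b] (n : ℕ) :
    ⌊x * b ^ (n + 1)⌋₊ = b * ⌊x * b ^ n⌋₊ + Real.digits x b n := by
  have hdiv : ⌊x * b ^ n⌋₊ = ⌊x * b ^ (n + 1)⌋₊ / b := by
    have hb : (b : ℝ) ≠ 0 := NeZero.ne _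
    rw [← Nat.floor_div_natCast, pow_succ, ← mul_assoc, mul_div_cancel_right₀ _ hb]
  rw [hdiv, Real.digits, Fin.val_ofNat, Nat.div_add_mod]

theorem appendBits_floor_binaryDigit (x : ℝ) (n : ℕ) :
    appendBits ⌊x⌋₊ ((List.range n).map (binaryDigit x)) = ⌊x * 2 ^ n⌋₊ := by
  induction n with
  | zero => simp [appendBits]
  | succ n ih =>
    have hdigit : ∀ d : Fin 2, (finTwoEquiv d).toNat = d := by decide
    have hfloor := floor_mul_pow_succ_eq x 2 n
    rw [Nat.cast_ofNat] at hfloor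
    rw [hfloor, ← ih, ← hdigit, ← binaryDigit, ← Nat.bit_val, List.range_succ, List.map_append]
    simp only [appendBits, List.foldl_append, List.map_cons, List.map_nil, List.foldl_cons,
      List.foldl_nil]

theorem primrec_appendBits (a : ℕ) : Primrec (appendBits a) := by
  have hbit : Primrec₂ Nat.bit :=
    Primrec.cond .fst (Primrec.nat_double_succ.comp .snd) (Primrec.nat_double.comp .snd)
  exact Primrec.list_foldl .id (.const a)
    (hbit.comp (Primrec.snd.comp .snd) (Primrec.fst.comp .snd)).to₂

end BinaryDigits

namespace BitComputer

variable (U : BitComputer)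

/-- The fresh string of the first stage `t` with `a.x - 2 ^ (-n) < omegaAt t`, where `a.x` is the
number with integer part `a` whose first `n` binary digits are the string `x` of length `n`.
The integer part of `Ω` is a separate parameter since `Ω = 1` is not excluded. -/
def freshStringAfter (a : ℕ) : List Bool →. List Bool := fun x =>
  (Nat.rfind fun t : ℕ => Part.some <| decide
    (appendBits a x * 2 ^ t < 2 ^ x.length * U.scaledOmegaAt t + 2 ^ t)).map U.freshString

theorem partrec_freshStringAfter (a : ℕ) : Partrec (U.freshStringAfter a) := by
  have htarget : Computable fun q : List Bool × ℕ => appendBits a q.1 * 2 ^ q.2 :=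
    (Primrec.nat_mul.comp ((primrec_appendBits a).comp .fst) (primrec_two_pow.comp .snd)).to_comp
  have hscaled : Computable fun q : List Bool × ℕ =>
      2 ^ q.1.length * U.scaledOmegaAt q.2 + 2 ^ q.2 :=
    Primrec.nat_add.to_comp.comp
      (Primrec.nat_mul.to_comp.comp
        (primrec_two_pow.comp (Primrec.list_length.comp .fst)).to_comp
        (U.computable_scaledOmegaAt.comp .snd))
      (primrec_two_pow.comp .snd).to_comp
  have htest := Primrec.nat_lt.decide.to_comp.comp htarget hscaled
  exact (Partrec.rfind htest.to₂.partrec₂).map (U.computable_freshString.comp .snd).to₂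

variable {U} in
theorem mul_two_pow_lt_scaledOmegaAt_iff {m n t : ℕ} :
    m * 2 ^ t < 2 ^ n * U.scaledOmegaAt t + 2 ^ t ↔ (m : ℝ) < 2 ^ n * U.omegaAt t + 1 := by
  have h2t : (0 : ℝ) < 2 ^ t := by positivity
  rw [← Nat.cast_lt (α := ℝ), ← mul_lt_mul_iff_left₀ h2t (c := 2 ^ n * U.omegaAt t + 1)]
  push_cast
  rw [cast_scaledOmegaAt]
  ring_nf

theorem exists_mem_freshStringAfter (n : ℕ) :
    ∃ y ∈ U.freshStringAfter ⌊U.omega⌋₊ ((List.range n).map (binaryDigit U.omega)),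
      (n : ℕ∞) ≤ complexity U.eval y := by
  have h2n : (0 : ℝ) < 2 ^ n := by positivity
  have homega : 0 ≤ U.omega := tsum_nonneg fun _ => by positivity
  have hinv : (1 / 2 : ℝ) ^ n * 2 ^ n = 1 := by rw [← mul_pow]; norm_num
  obtain ⟨t₀, ht₀⟩ : ∃ t, U.omega - (1 / 2) ^ n < U.omegaAt t :=
    exists_lt_omegaAt (sub_lt_self _ (by positivity))
  have hhalt : (⌊U.omega * 2 ^ n⌋₊ : ℝ) < 2 ^ n * U.omegaAt t₀ + 1 := by
    nlinarith [Nat.floor_le (mul_nonneg homega h2n.le)]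
  obtain ⟨t, ht, -⟩ := Nat.rfind_min'
    (p := fun t => ⌊U.omega * 2 ^ n⌋₊ * 2 ^ t < 2 ^ n * U.scaledOmegaAt t + 2 ^ t)
    (decide_eq_true (mul_two_pow_lt_scaledOmegaAt_iff.2 hhalt))
  refine ⟨U.freshString t, ?_, le_complexity_freshString ?_⟩
  · rw [freshStringAfter, appendBits_floor_binaryDigit, List.length_map, List.length_range]
    exact Part.mem_map _ ht
  · have hfresh := mul_two_pow_lt_scaledOmegaAt_iff.1
      (of_decide_eq_true (Part.mem_some_iff.1 (Nat.rfind_spec ht)).symm)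
    nlinarith [Nat.lt_floor_add_one (U.omega * 2 ^ n)]

variable {U} in
theorem IsUniversal.exists_le_complexity_omega (hU : U.IsUniversal) :
    ∃ c : ℕ, ∀ n : ℕ,
      (n : ℕ∞) ≤ complexity U.eval ((List.range n).map (binaryDigit U.omega)) + c := by
  obtain ⟨c, hc⟩ :=
    hU.exists_complexity_le_of_partrec (U.partrec_freshStringAfter ⌊U.omega⌋₊)
  refine ⟨c, fun n => ?_⟩
  obtain ⟨y, hy, hny⟩ := U.exists_mem_freshStringAfter n
  exact hny.trans (hc _ y hy)

end BitComputer

/-! ### Decoding bits from a theory -/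

namespace BitComputer

section TheoryDecoder

variable (U : BitComputer) (B : ℕ → Bool → List Bool)

/-- The string displayed at time `i` of the computation on `v`. -/
def displayAt (v : List Bool) (i : ℕ) : Option (List Bool) :=
  (U.run v i).bind fun c => U.display c.1

/-- The strings displayed up to time `s` of the computation on `v`. -/
def displayedBy (v : List Bool) (s : ℕ) : List (List Bool) :=
  (List.range (s + 1)).filterMap (U.displayAt v)

/-- The value of the `k`-th bit according to a list `L` of theorems, where `B k b` is the sentence
"the `k`-th bit is `b`". -/
def settledBit (L : List (List Bool)) (k : ℕ) : Option Bool :=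
  [true, false].find? fun b => B k b ∈ L

/-- What the strings displayed on `v` up to time `s` say about the first `s` bits. -/
def settledBits (v : List Bool) (s : ℕ) : List (Option Bool) :=
  (List.range s).map (settledBit B (U.displayedBy v s))

/-- The number of those among the first `s` bits that are not settled at time `s`. -/
def unsettledCount (v : List Bool) (s : ℕ) : ℕ :=
  (U.settledBits B v s).countP Option.isNone

/-- At time `s`, at least `k` more of the first `s` bits have been settled than bits of `v` have
been read. Both sides are arranged so that no subtraction occurs. -/
def hasSurplus (k : ℕ) (v : List Bool) (s : ℕ) : Bool :=
  (U.run v s).any fun c => v.length + k + U.unsettledCount B v s ≤ s + c.2.length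

/-- The first `s` bits, if the part of `v` left unread at time `s` lists those not settled. -/
def completion (v : List Bool) (s : ℕ) : Option (List Bool) :=
  (U.run v s).bind fun c =>
    if c.2.length = U.unsettledCount B v s then some (fillGaps (U.settledBits B v s) c.2) else none

/-- The computer that runs `U` on its input until there is a surplus of `k` settled bits, and then
takes the bits that are not settled from the unread part of the input. -/
def theoryDecoder (k : ℕ) : List Bool →. List Bool := fun v =>
  (Nat.rfind (U.hasSurplus B k v)).bind fun s => U.completion B v s

section Computability

variable {B}

theorem computable_displayedBy : Computable₂ U.displayedBy := by
  have hdisplay : Computable₂ U.displayAt :=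
    Computable.option_bind U.computable_run
      (U.computable_display.comp (Computable.fst.comp .snd)).to₂
  exact computable_filterMap_range (Computable.succ.comp .snd)
    (hdisplay.comp (Computable.fst.comp .fst) .snd).to₂

theorem computable_settledBit (hB : Computable₂ B) : Computable₂ (settledBit B) := by
  have hmem (b : Bool) : Computable fun q : List (List Bool) × ℕ => decide (B q.2 b ∈ q.1) :=
    primrecRel_mem_list.decide.to_comp.comp (hB.comp .snd (.const b)) .fst
  refine (Computable.cond (hmem true) (.const (some true))
    (.cond (hmem false) (.const (some false)) (.const none))).of_eq fun q => ?_
  by_cases htrue : B q.2 true ∈ q.1 <;> by_cases hfalse : B q.2 false ∈ q.1 <;>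
    simp [settledBit, htrue, hfalse]

theorem computable_settledBits (hB : Computable₂ B) : Computable₂ (U.settledBits B) := by
  have hsettled : Computable₂ fun (q : List Bool × ℕ) (k : ℕ) =>
      settledBit B (U.displayedBy q.1 q.2) k :=
    (computable_settledBit hB).comp
      (U.computable_displayedBy.comp (Computable.fst.comp .fst) (Computable.snd.comp .fst)) .snd
  exact computable_map_range .snd hsettled

theorem computable_unsettledCount (hB : Computable₂ B) : Computable₂ (U.unsettledCount B) := by
  have hcount : Primrec fun l : List (Option Bool) => l.countP Option.isNone :=
    (Primrec.list_length.comp (Primrec.listFilter (p := fun o : Option Bool => o = none)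
      (Primrec.eq.comp .id (.const none)))).of_eq fun l => by
        rw [List.countP_eq_length_filter]
        congr 2
        ext o
        cases o <;> rfl
  exact hcount.to_comp.comp (U.computable_settledBits hB)

theorem computable_hasSurplus (hB : Computable₂ B) :
    Computable₂ fun (q : ℕ × List Bool) (s : ℕ) => U.hasSurplus B q.1 q.2 s := by
  have hneeded : Computable fun q : (ℕ × List Bool) × ℕ =>
      q.1.2.length + q.1.1 + U.unsettledCount B q.1.2 q.2 :=
    Primrec.nat_add.to_comp.comp
      (Primrec.nat_add.comp (Primrec.list_length.comp (Primrec.snd.comp .fst))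
        (Primrec.fst.comp .fst)).to_comp
      ((U.computable_unsettledCount hB).comp (Computable.snd.comp .fst) .snd)
  have havailable : Primrec fun q : ((ℕ × List Bool) × ℕ) × (ℕ × List Bool) =>
      q.1.2 + q.2.2.length :=
    Primrec.nat_add.comp (Primrec.snd.comp .fst) (Primrec.list_length.comp (Primrec.snd.comp .snd))
  have htest : Computable₂ fun (q : (ℕ × List Bool) × ℕ) (c : ℕ × List Bool) =>
      decide (q.1.2.length + q.1.1 + U.unsettledCount B q.1.2 q.2 ≤ q.2 + c.2.length) :=
    Primrec.nat_le.decide.to_comp.comp (hneeded.comp .fst) havailable.to_comp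
  refine (Computable.option_getD (Computable.option_map
    (U.computable_run.comp (Computable.snd.comp .fst) .snd) htest) (.const false)).of_eq fun q => ?_
  cases hrun : U.run q.1.2 q.2 <;> simp [hasSurplus, hrun]

theorem computable_completion (hB : Computable₂ B) : Computable₂ (U.completion B) := by
  have htest : Computable₂ fun (q : List Bool × ℕ) (c : ℕ × List Bool) =>
      decide (c.2.length = U.unsettledCount B q.1 q.2) :=
    Primrec.eq.decide.to_comp.comp (Primrec.list_length.comp (Primrec.snd.comp .snd)).to_comp
      ((U.computable_unsettledCount hB).comp (Computable.fst.comp .fst) (Computable.snd.comp .fst))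
  have hfill : Computable₂ fun (q : List Bool × ℕ) (c : ℕ × List Bool) =>
      some (fillGaps (U.settledBits B q.1 q.2) c.2) :=
    Computable.option_some.comp (primrec_fillGaps.to_comp.comp
      ((U.computable_settledBits hB).comp (Computable.fst.comp .fst) (Computable.snd.comp .fst))
      (Computable.snd.comp .snd))
  refine (Computable.option_bind U.computable_run
    (Computable.cond htest hfill (.const none)).to₂).of_eq fun q => ?_
  simp only [completion, Bool.cond_decide]

theorem partrec_theoryDecoder (hB : Computable₂ B) : Partrec₂ (U.theoryDecoder B) :=
  (Partrec.rfind (U.computable_hasSurplus hB).partrec₂).bind (Computable.ofOption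
    ((U.computable_completion hB).comp (Computable.snd.comp .fst) .snd)).to₂

end Computability

variable {U B}

theorem displayedBy_append {v : List Bool} {s : ℕ} (h : (U.run v s).isSome) (r : List Bool) :
    U.displayedBy (v ++ r) s = U.displayedBy v s := by
  refine List.filterMap_congr fun i hi => ?_
  obtain ⟨⟨τ, w⟩, hrun⟩ := Option.isSome_iff_exists.1
    (isSome_run_of_le (Nat.lt_succ_iff.1 (List.mem_range.1 hi)) h)
  rw [displayAt, displayAt, hrun, run_append hrun, Option.bind_some, Option.bind_some]

theorem settledBits_append {v : List Bool} {s : ℕ} (h : (U.run v s).isSome) (r : List Bool) :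
    U.settledBits B (v ++ r) s = U.settledBits B v s := by
  rw [settledBits, settledBits, displayedBy_append h]

theorem unsettledCount_append {v : List Bool} {s : ℕ} (h : (U.run v s).isSome) (r : List Bool) :
    U.unsettledCount B (v ++ r) s = U.unsettledCount B v s :=
  congrArg (List.countP Option.isNone) (settledBits_append h r)

theorem hasSurplus_append {v : List Bool} {s : ℕ} (h : (U.run v s).isSome) (k : ℕ)
    (r : List Bool) : U.hasSurplus B k (v ++ r) s = U.hasSurplus B k v s := by
  obtain ⟨⟨τ, w⟩, hrun⟩ := Option.isSome_iff_exists.1 h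
  simp only [hasSurplus, unsettledCount_append h, hrun, run_append hrun, Option.any_some,
    List.length_append]
  lia

theorem mem_completion {v x : List Bool} {s : ℕ} :
    x ∈ U.completion B v s ↔ ∃ σ z, U.run v s = some (σ, z) ∧
      z.length = U.unsettledCount B v s ∧ fillGaps (U.settledBits B v s) z = x := by
  simp [completion, Option.bind_eq_some_iff]

theorem mem_theoryDecoder {k : ℕ} {v x : List Bool} :
    x ∈ U.theoryDecoder B k v ↔ ∃ s, U.hasSurplus B k v s = true ∧
      (∀ i < s, U.hasSurplus B k v i = false) ∧ x ∈ U.completion B v s := by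
  refine Part.mem_bind_iff.trans (exists_congr fun s => ?_)
  simp only [Nat.mem_rfind, Part.mem_coe, PFun.coe_val, Part.mem_some_iff, and_assoc,
    eq_comm (b := U.hasSurplus B k v _)]

theorem isAntichain_dom_theoryDecoder (k : ℕ) :
    IsAntichain (· <+: ·) (U.theoryDecoder B k).Dom := by
  rintro v hv _ hvr hne ⟨r, rfl⟩
  obtain ⟨x, hx⟩ := Part.dom_iff_mem.1 hv
  obtain ⟨y, hy⟩ := Part.dom_iff_mem.1 hvr
  obtain ⟨s, hs, hmin, hcompl⟩ := mem_theoryDecoder.1 hx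
  obtain ⟨s', hs', hmin', hcompl'⟩ := mem_theoryDecoder.1 hy
  obtain ⟨σ, z, hrun, hz, -⟩ := mem_completion.1 hcompl
  obtain ⟨σ', z', hrun', hz', -⟩ := mem_completion.1 hcompl'
  have hsurplus : ∀ i ≤ s, U.hasSurplus B k (v ++ r) i = U.hasSurplus B k v i := fun i hi =>
    hasSurplus_append (isSome_run_of_le hi (by simp [hrun])) k r
  obtain rfl : s = s' := by
    rcases lt_trichotomy s s' with hlt | heq | hlt
    · exact absurd ((hsurplus s le_rfl).trans hs) (by simp [hmin' s hlt])
    · exact heq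
    · exact absurd ((hsurplus s' hlt.le).symm.trans hs') (by simp [hmin s' hlt])
  rw [run_append hrun] at hrun'
  cases hrun'
  rw [unsettledCount_append (by simp [hrun]), ← hz, List.length_append,
    Nat.add_eq_left, List.length_eq_zero_iff] at hz'
  exact hne (by rw [hz', List.append_nil])

theorem mem_of_settledBit_eq_some {L : List (List Bool)} {k : ℕ} {b : Bool}
    (h : settledBit B L k = some b) : B k b ∈ L :=
  of_decide_eq_true (List.find?_some h :)

theorem isSome_settledBit {L : List (List Bool)} {k : ℕ} {b : Bool} (h : B k b ∈ L) :
    (settledBit B L k).isSome :=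
  List.find?_isSome.2 ⟨b, by cases b <;> decide, decide_eq_true h⟩

theorem mem_displayedBy {p x : List Bool} {s : ℕ} :
    x ∈ U.displayedBy p s ↔ ∃ i ≤ s, U.displayAt p i = some x := by
  simp [displayedBy]

theorem displays_iff_exists_displayAt {p x : List Bool} :
    U.Displays p x ↔ ∃ i, U.displayAt p i = some x := by
  simp [Displays, displayAt, Option.bind_eq_some_iff]

theorem forall₂_settledBits {X : ℕ → Bool} {p : List Bool}
    (hsound : ∀ i b, U.Displays p (B i b) → X i = b) (s : ℕ) :
    List.Forall₂ (fun o a => ∀ b ∈ o, b = a) (U.settledBits B p s) ((List.range s).map X) := by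
  rw [settledBits, List.forall₂_map_left_iff, List.forall₂_map_right_iff, List.forall₂_same]
  intro i _ b hb
  obtain ⟨t, -, ht⟩ := mem_displayedBy.1 (mem_of_settledBit_eq_some hb)
  exact (hsound i b (displays_iff_exists_displayAt.2 ⟨t, ht⟩)).symm

theorem exists_mem_theoryDecoder {X : ℕ → Bool} {p : List Bool} {k : ℕ}
    (hsound : ∀ i b, U.Displays p (B i b) → X i = b) (h : ∃ s, U.hasSurplus B k p s = true) :
    ∃ w s, (List.range s).map X ∈ U.theoryDecoder B k w ∧ w.length + k ≤ s := by
  obtain ⟨s, hs, hmin⟩ := Nat.findX h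
  obtain ⟨⟨σ, rest⟩, hrun, hle⟩ := (Option.any_eq_true _ _).1 hs
  obtain ⟨z, hz, hfill⟩ := exists_fillGaps_eq (forall₂_settledBits hsound s)
  obtain ⟨p, rfl, hp⟩ := exists_run_prefix hrun
  have hps : (U.run p s).isSome := by simp [hp]
  have hsurplus : ∀ i ≤ s, U.hasSurplus B k (p ++ z) i = U.hasSurplus B k (p ++ rest) i :=
    fun i hi => by
      rw [hasSurplus_append (isSome_run_of_le hi hps), hasSurplus_append (isSome_run_of_le hi hps)]
  have hsettled : U.settledBits B (p ++ z) s = U.settledBits B (p ++ rest) s := by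
    rw [settledBits_append hps, settledBits_append hps]
  refine ⟨p ++ z, s, mem_theoryDecoder.2 ⟨s, (hsurplus s le_rfl).trans hs, fun i hi => ?_,
    mem_completion.2 ⟨σ, z, run_append hp z, ?_, ?_⟩⟩, ?_⟩
  · rw [hsurplus i hi.le]
    exact eq_false_of_ne_true (hmin i hi)
  · rw [unsettledCount, hsettled, hz]
  · rw [hsettled, hfill]
  · have hle' := of_decide_eq_true hle
    simp only [unsettledCount, ← hz, List.length_append] at hle' ⊢
    lia

theorem eventually_isSome_settledBit {p : List Bool} {i : ℕ} {b : Bool}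
    (h : U.Displays p (B i b)) :
    ∀ᶠ s in atTop, (settledBit B (U.displayedBy p s) i).isSome := by
  obtain ⟨t, ht⟩ := displays_iff_exists_displayAt.1 h
  filter_upwards [eventually_ge_atTop t] with s hts
  exact isSome_settledBit (mem_displayedBy.2 ⟨t, hts, ht⟩)

theorem card_add_unsettledCount_le {p : List Bool} {s : ℕ} {K : Finset ℕ}
    (hK : ∀ i ∈ K, i < s ∧ (settledBit B (U.displayedBy p s) i).isSome) :
    K.card + U.unsettledCount B p s ≤ s := by
  have hsubset : K ⊆ ((List.range s).filter fun i =>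
      (settledBit B (U.displayedBy p s) i).isSome).toFinset := fun i hi => by simpa using hK i hi
  have hcard : K.card ≤ (U.settledBits B p s).countP Option.isSome := by
    rw [settledBits, List.countP_map, List.countP_eq_length_filter]
    exact (Finset.card_le_card hsubset).trans (List.toFinset_card_le _)
  have hlength : (U.settledBits B p s).length = s := by simp [settledBits]
  have hnone : (fun o : Option Bool => decide ¬o.isSome) = Option.isNone := by
    ext o
    cases o <;> rfl
  rw [List.length_eq_countP_add_countP Option.isSome, hnone] at hlength
  rw [unsettledCount]
  lia

theorem exists_hasSurplus {p : List Bool} {k : ℕ} (hrun : ∀ n, U.run p n ≠ none)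
    (h : (p.length + k : ℕ) ≤ {i | ∃ b, U.Displays p (B i b)}.encard) :
    ∃ s, U.hasSurplus B k p s = true := by
  obtain ⟨K, hK, hcard⟩ := Set.exists_subset_encard_eq h
  lift K to Finset ℕ using Set.finite_of_encard_eq_coe hcard
  rw [Set.encard_coe_eq_coe_finsetCard, Nat.cast_inj] at hcard
  have hsettled : ∀ᶠ s in atTop, ∀ i ∈ K,
      i < s ∧ (settledBit B (U.displayedBy p s) i).isSome :=
    (eventually_all_finset K).2 fun i hi =>
      (eventually_gt_atTop i).and (eventually_isSome_settledBit (hK hi).choose_spec)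
  obtain ⟨s, hs⟩ := hsettled.exists
  obtain ⟨c, hc⟩ := Option.ne_none_iff_exists'.1 (hrun s)
  refine ⟨s, (Option.any_eq_true _ _).2 ⟨c, hc, decide_eq_true ?_⟩⟩
  rw [← hcard]
  exact (card_add_unsettledCount_le hs).trans (Nat.le_add_right _ _)

end TheoryDecoder

variable {U : BitComputer}

theorem IsUniversal.exists_encard_displays_le (hU : U.IsUniversal) {B : ℕ → Bool → List Bool}
    (hB : Computable₂ B) {X : ℕ → Bool} {c : ℕ}
    (hX : ∀ n : ℕ, (n : ℕ∞) ≤ complexity U.eval ((List.range n).map X) + c) :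
    ∃ d : ℕ, ∀ p, (∀ n, U.run p n ≠ none) → (∀ k b, U.Displays p (B k b) → X k = b) →
      {k | ∃ b, U.Displays p (B k b)}.encard ≤ p.length + d := by
  have hE : Partrec₂ fun k => U.theoryDecoder B (2 * k) :=
    (U.partrec_theoryDecoder hB).comp (Primrec.nat_double.to_comp.comp .fst) .snd
  obtain ⟨d, hd⟩ := hU.exists_complexity_le_of_family hE fun k => isAntichain_dom_theoryDecoder _
  let k := c + d + 1
  refine ⟨2 * k, fun p hrun hsound => ?_⟩
  by_contra! hlt
  obtain ⟨w, s, hmem, hle⟩ :=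
    exists_mem_theoryDecoder hsound (exists_hasSurplus (k := 2 * k) hrun (by exact_mod_cast hlt.le))
  have hs : (s : ℕ∞) ≤ (w.length + k + d + c : ℕ) :=
    calc
      (s : ℕ∞) ≤ complexity U.eval ((List.range s).map X) + c := hX s
      _ ≤ (w.length + k + d : ℕ) + c := by
        gcongr
        exact hd k w _ hmem
      _ = (w.length + k + d + c : ℕ) := (Nat.cast_add _ _).symm
  have hs' : s ≤ w.length + k + d + c := Nat.cast_le.1 hs
  lia

theorem exists_enumerates_of_theoryComplexity_eq {T : Set (List Bool)} {N : ℕ}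
    (h : U.theoryComplexity T = N) : ∃ p, U.Enumerates p T ∧ p.length ≤ N := by
  have hlt : U.theoryComplexity T < (N + 1 : ℕ) := h ▸ Nat.cast_lt.2 N.lt_succ_self
  simp only [theoryComplexity, iInf_lt_iff, Nat.cast_lt, Nat.lt_succ_iff, exists_prop] at hlt
  exact hlt

end BitComputer

theorem mainTheorem1 (U : BitComputer) (hU : U.IsUniversal)
    -- the true sentences of a language, and its sentences "bit `k` of `Ω` is `b`",
    -- where bit `0` is the first one after the binary point
    (Truth : Set (List Bool)) (bitSentence : ℕ → Fin 2 → List Bool)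
    (hcomp : Computable₂ bitSentence)
    (hbit : ∀ k b, bitSentence k b ∈ Truth ↔ Real.digits U.omega 2 k = b) :
    ∃ c : ℕ, ∀ (T : Set (List Bool)) (N : ℕ), T ⊆ Truth → U.theoryComplexity T = N →
      {k : ℕ | ∃ b, bitSentence k b ∈ T}.encard ≤ N + c := by
  obtain ⟨c₁, hc₁⟩ := hU.exists_le_complexity_omega
  have hB : Computable₂ fun k b => bitSentence k (finTwoEquiv.symm b) :=
    hcomp.comp .fst ((Primrec.dom_bool _).to_comp.comp .snd)
  obtain ⟨c, hc⟩ := hU.exists_encard_displays_le hB hc₁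
  refine ⟨c, fun T N hT hN => ?_⟩
  obtain ⟨p, ⟨hrun, -, hdisp⟩, hp⟩ := BitComputer.exists_enumerates_of_theoryComplexity_eq hN
  have hsound (k : ℕ) (b : Bool) (h : U.Displays p (bitSentence k (finTwoEquiv.symm b))) :
      binaryDigit U.omega k = b := by
    rw [binaryDigit, (hbit k _).1 (hT ((hdisp _).1 h)), Equiv.apply_symm_apply]
  have hsettled : {k | ∃ b, bitSentence k b ∈ T} =
      {k | ∃ b, U.Displays p (bitSentence k (finTwoEquiv.symm b))} := by
    simp only [hdisp, finTwoEquiv.symm.surjective.exists]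
  calc
    {k | ∃ b, bitSentence k b ∈ T}.encard ≤ p.length + c := hsettled ▸ hc p hrun hsound
    _ ≤ N + c := by gcongr
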